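/- Let $n\ge 1$, $0<s<1$, $1<p<\infty$, and let $C_{n,sp}>0$ be any fixed normalization constant. For $u:\mathbb R^n\to\mathbb R$ let $$(-\Delta)^s_p u(x)=C_{n,sp}\lim_{\varepsilon\to0^+}\int_{\mathbb R^n\setminus B_\varepsilon(x)}\frac{|u(x)-u(y)|^{p-2}\,(u(x)-u(y))}{|x-y|^{n+sp}}\,dy$$ whenever these integrals converge absolutely and the limit exists. Let $L_{sp}$ be the set of $u\in L^1_{loc}(\mathbb R^n)$ with $\int_{\mathbb R^n}\frac{|u(x)|}{1+|x|^{n+sp}}\,dx<\infty$, and let $C^{1,1}_{loc}$ be the set of $C^1$ functions on $\mathbb R^n$ with locally Lipschitz gradient. Let $g$ be locally Lipschitz on $(0,\infty)$ (for example $g\in C^1((0,\infty))$), and assume that for some $\delta>0$, $g$ is differentiable on $(0,\delta)$ with $g'(t)\le0$ for all $t\in(0,\delta)$. Let $u\in C^{1,1}_{loc}\cap L_{sp}$ satisfy $u(x)>0$ for every $x\in\mathbb R^n$, $u(x)\to0$ as $|x|\to\infty$, and suppose that for every $x\in\mathbb R^n$ the value $(-\Delta)^s_p u(x)$ exists and $$(-\Delta)^s_p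 u(x)=g(u(x)).$$ Then $u$ is radially symmetric and strictly decreasing about some point: there are $x_0\in\mathbb R^n$ and a strictly decreasing function $\varphi:[0,\infty)\to\mathbb R$ such that $u(x)=\varphi(|x-x_0|)$ for all $x\in\mathbb R^n$. -/

import Mathlib

open Set Filter Topology MeasureTheory

/-- `C^{1,1}_loc(ℝⁿ)`: continuously differentiable with locally Lipschitz derivative. -/
def IsC11Loc {n : ℕ} (u : EuclideanSpace ℝ (Fin n) → ℝ) : Prop :=
  ContDiff ℝ 1 u ∧ LocallyLipschitz (fderiv ℝ u)

/-- The space `L_{sp}`: locally integrable functions `u` on `ℝⁿ` with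
`∫ |u(x)| / (1 + |x|^{n+sp}) dx < ∞`. -/
def MemLsp {n : ℕ} (s p : ℝ) (u : EuclideanSpace ℝ (Fin n) → ℝ) : Prop :=
  LocallyIntegrable u volume ∧
    Integrable (fun x => |u x| / (1 + ‖x‖ ^ ((n : ℝ) + s * p))) volume

/-- The integrand `|u(x)-u(y)|^{p-2} (u(x)-u(y)) / |x-y|^{n+sp}`. -/
noncomputable def fracPLaplacianIntegrand {n : ℕ} (s p : ℝ)
    (u : EuclideanSpace ℝ (Fin n) → ℝ) (x y : EuclideanSpace ℝ (Fin n)) : ℝ :=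
  |u x - u y| ^ (p - 2) * (u x - u y) / ‖x - y‖ ^ ((n : ℝ) + s * p)

/-- The fractional `p`-Laplacian of `u`, normalized by the constant `C`, exists at `x` as a
Cauchy principal value and is equal to `v`: the integral over the complement of each ball
`B_ε(x)` converges absolutely, and `C` times it tends to `v` as `ε → 0+`. -/
def HasFracPLaplacianAt {n : ℕ} (C s p : ℝ) (u : EuclideanSpace ℝ (Fin n) → ℝ)
    (x : EuclideanSpace ℝ (Fin n)) (v : ℝ) : Prop :=
  (∀ ε : ℝ, 0 < ε →
    IntegrableOn (fracPLaplacianIntegrand s p u x) (Metric.ball x ε)ᶜ volume) ∧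
  Tendsto (fun ε : ℝ => C * ∫ y in (Metric.ball x ε)ᶜ, fracPLaplacianIntegrand s p u x y)
    (𝓝[>] 0) (𝓝 v)

/-- `u` is radially symmetric and (strictly) monotone decreasing about the point `x₀`. -/
def IsRadiallyDecreasingAbout {n : ℕ} (u : EuclideanSpace ℝ (Fin n) → ℝ)
    (x₀ : EuclideanSpace ℝ (Fin n)) : Prop :=
  ∃ φ : ℝ → ℝ, StrictAntiOn φ (Ici 0) ∧ ∀ x, u x = φ ‖x - x₀‖

/-! The proof is the method of moving planes. Let R be the reflection in {⟪e,y⟫ = μ}, H = {⟪e,y⟫ <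
μ} and w = u∘R - u. Subtracting the principal value at x from the one at Rx and folding the integral
onto H gives the integrand A·K(x,y) + B·K(x,Ry), with K the kernel and A, B differences of odd
powers. If w has a nonpositive minimum over H at x, then A ≤ 0 and A + B ≤ 0; since K(x,y) >
K(x,Ry), the integrand is nonpositive, and strict negativity on a ball survives integration
(`fracPLaplacian_reflect_sub_le`).

At a negative minimum this gives g(u(Rx)) < g(u(x)), which the monotonicity of g near 0 forbids
unless u(x) ≥ δ (`le_of_negative_min`). Negative minima thus stay in a fixed compact set, so planes
far out can be started. If w ≥ 0 vanishes at one point of H, it vanishes everywhere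
(`strict_or_symmetric`).

If w > 0 on H at some level, negative minima for slightly larger levels could only accumulate on the
plane. At distance d from it, `boundary_estimate` makes the difference of the values of g at most
-c·d, whereas the vanishing of the derivative along e at the limit point and the Lipschitz bound on
g make it o(d) (`exists_moving_plane_step`). Hence every direction has a symmetry plane; all of them
pass through a maximum point of u, about which u is radial. -/

/-! ### Odd powers and a tangent-line inequality. -/

/-- The odd power `t ↦ |t|^{p-2} t`. -/
noncomputable def oddPow (p t : ℝ) : ℝ := |t| ^ (p - 2) * t

lemma oddPow_of_nonneg {p t : ℝ} (hp : 1 < p) (ht : 0 ≤ t) : oddPow p t = t ^ (p - 1) := by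
  rcases ht.eq_or_lt with rfl | ht
  · simp [oddPow, Real.zero_rpow (by linarith : p - 1 ≠ 0)]
  · rw [oddPow, abs_of_pos ht, ← Real.rpow_add_one ht.ne']
    congr 1; ring

lemma oddPow_neg (p t : ℝ) : oddPow p (-t) = -oddPow p t := by
  simp [oddPow]

lemma oddPow_strictMono {p : ℝ} (hp : 1 < p) : StrictMono (oddPow p) := by
  refine strictMono_of_odd_strictMonoOn_nonneg (oddPow_neg p) fun a ha b hb hab => ?_
  rw [oddPow_of_nonneg hp ha, oddPow_of_nonneg hp hb]
  exact Real.rpow_lt_rpow ha hab (by linarith)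

lemma oddPow_continuous {p : ℝ} (hp : 1 < p) : Continuous (oddPow p) := by
  -- This form avoids the factor |t|^{p-2}, singular at 0 when p < 2.
  have h : oddPow p = fun t => max t 0 ^ (p - 1) - max (-t) 0 ^ (p - 1) := by
    ext t
    have h0 : (0 : ℝ) ^ (p - 1) = 0 := Real.zero_rpow (by linarith)
    rcases le_total 0 t with ht | ht
    · rw [oddPow_of_nonneg hp ht, max_eq_left ht, max_eq_right (by linarith), h0, sub_zero]
    · rw [← neg_neg t, oddPow_neg, oddPow_of_nonneg hp (by linarith : 0 ≤ -t), neg_neg,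
        max_eq_right ht, max_eq_left (by linarith), h0, zero_sub]
  rw [h]
  have hq : ∀ x : ℝ, x ≠ 0 ∨ 0 ≤ p - 1 := fun _ => Or.inr (by linarith)
  exact ((continuous_id.max continuous_const).rpow_const fun _ => hq _).sub
    ((continuous_neg.max continuous_const).rpow_const fun _ => hq _)

/-- A convexity bound for the decreasing function `r ↦ r^{-b}`. -/
lemma rpow_neg_sub_rpow_neg_ge {b r q : ℝ} (hb : 0 < b) (hr : 0 < r) (hq : 0 < q) :
    b * (q - r) * q ^ (-b - 1) ≤ r ^ (-b) - q ^ (-b) := by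
  -- With t = r/q: t^{-b} = exp(-b log t) ≥ 1 - b log t ≥ 1 + b(1 - t).
  have h1 : 1 + b * (1 - r / q) ≤ (r / q) ^ (-b) := by
    rw [Real.rpow_def_of_pos (div_pos hr hq)]
    have h2 := Real.add_one_le_exp (Real.log (r / q) * -b)
    have h3 := mul_le_mul_of_nonneg_left (Real.log_le_sub_one_of_pos (div_pos hr hq)) hb.le
    linarith
  rw [Real.div_rpow hr.le hq.le, le_div_iff₀ (Real.rpow_pos_of_pos hq _)] at h1
  have h4 : q ^ (-b - 1) = q ^ (-b) / q := Real.rpow_sub_one hq.ne' _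
  rw [h4]
  have h5 : b * (q - r) * (q ^ (-b) / q) = b * (1 - r / q) * q ^ (-b) := by
    field_simp
  rw [h5]; linarith

/-! ### Reflections in hyperplanes. -/

section Reflection

variable {n : ℕ}

/-- The reflection of `ℝⁿ` in the hyperplane `{y | ⟪e, y⟫ = μ}`, for a unit vector `e`. -/
noncomputable def planeReflect (e : EuclideanSpace ℝ (Fin n)) (μ : ℝ)
    (x : EuclideanSpace ℝ (Fin n)) : EuclideanSpace ℝ (Fin n) :=
  x + (2 * (μ - inner ℝ e x)) • e

lemma continuous_planeReflect_uncurry (e : EuclideanSpace ℝ (Fin n)) :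
    Continuous fun q : ℝ × EuclideanSpace ℝ (Fin n) => planeReflect e q.1 q.2 := by
  unfold planeReflect; fun_prop

@[fun_prop]
lemma Continuous.planeReflect {X : Type*} [TopologicalSpace X] (e : EuclideanSpace ℝ (Fin n))
    {f : X → ℝ} {h : X → EuclideanSpace ℝ (Fin n)} (hf : Continuous f) (hh : Continuous h) :
    Continuous fun x => planeReflect e (f x) (h x) :=
  (continuous_planeReflect_uncurry e).comp (hf.prodMk hh)

lemma Filter.Tendsto.planeReflect {X : Type*} {l : Filter X} (e : EuclideanSpace ℝ (Fin n))
    {f : X → ℝ} {h : X → EuclideanSpace ℝ (Fin n)} {a : ℝ} {b : EuclideanSpace ℝ (Fin n)}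
    (hf : Tendsto f l (𝓝 a)) (hh : Tendsto h l (𝓝 b)) :
    Tendsto (fun x => planeReflect e (f x) (h x)) l (𝓝 (planeReflect e a b)) :=
  ((continuous_planeReflect_uncurry e).tendsto (a, b)).comp (hf.prodMk_nhds hh)

lemma planeReflect_of_inner_eq {e : EuclideanSpace ℝ (Fin n)} {μ : ℝ}
    {x : EuclideanSpace ℝ (Fin n)} (h : inner ℝ e x = μ) : planeReflect e μ x = x := by
  simp [planeReflect, h]

variable {e : EuclideanSpace ℝ (Fin n)} (he : ‖e‖ = 1) (μ : ℝ)
include he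

lemma inner_planeReflect (x : EuclideanSpace ℝ (Fin n)) :
    inner ℝ e (planeReflect e μ x) = 2 * μ - inner ℝ e x := by
  rw [planeReflect, inner_add_right, real_inner_smul_right, real_inner_self_eq_norm_sq, he]; ring

lemma planeReflect_planeReflect (x : EuclideanSpace ℝ (Fin n)) :
    planeReflect e μ (planeReflect e μ x) = x := by
  conv_lhs => rw [planeReflect, inner_planeReflect he]
  rw [planeReflect, add_assoc, ← add_smul]
  ring_nf; simp

lemma planeReflect_add_smul (x : EuclideanSpace ℝ (Fin n)) (t : ℝ) :
    planeReflect e μ (x + t • e) = planeReflect e μ x - t • e := by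
  simp only [planeReflect, inner_add_right, real_inner_smul_right, real_inner_self_eq_norm_sq, he]
  module

/-- The correction is a product of signed distances: its sign orders the two kernels, and its
vanishing at the plane yields the linear factor in `boundary_estimate`. -/
lemma norm_sub_planeReflect_sq (x y : EuclideanSpace ℝ (Fin n)) :
    ‖x - planeReflect e μ y‖ ^ 2 =
      ‖x - y‖ ^ 2 + 4 * (μ - inner ℝ e x) * (μ - inner ℝ e y) := by
  have h : x - planeReflect e μ y = (x - y) - (2 * (μ - inner ℝ e y)) • e := by
    rw [planeReflect]; module
  rw [h, norm_sub_sq_real, real_inner_smul_right, norm_smul, he, inner_sub_left,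
    real_inner_comm e x, real_inner_comm e y, mul_one, Real.norm_eq_abs, sq_abs]
  ring

lemma norm_planeReflect_sub (x y : EuclideanSpace ℝ (Fin n)) :
    ‖planeReflect e μ x - planeReflect e μ y‖ = ‖x - y‖ := by
  refine (sq_eq_sq₀ (norm_nonneg _) (norm_nonneg _)).1 ?_
  rw [norm_sub_planeReflect_sq he, inner_planeReflect he, norm_sub_rev, norm_sub_planeReflect_sq he,
    norm_sub_rev]
  ring

lemma measurableEmbedding_planeReflect : MeasurableEmbedding (planeReflect e μ) := by
  have hc : Continuous (planeReflect e μ) := by fun_prop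
  exact (MeasurableEquiv.mk ⟨planeReflect e μ, planeReflect e μ, planeReflect_planeReflect he μ,
    planeReflect_planeReflect he μ⟩ hc.measurable hc.measurable).measurableEmbedding

lemma measurePreserving_planeReflect : MeasurePreserving (planeReflect e μ) volume volume := by
  have h : planeReflect e μ = fun x => (ℝ ∙ e)ᗮ.reflection x + (2 * μ) • e := by
    ext1 x
    rw [Submodule.reflection_orthogonal_apply, Submodule.reflection_singleton_apply, he, planeReflect]
    simp only [RCLike.ofReal_real_eq_id, id, one_pow, div_one]
    module
  rw [h]
  exact (measurePreserving_add_right volume ((2 * μ) • e)).comp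
    (LinearIsometryEquiv.measurePreserving _)

end Reflection

/-! ### Sign and size of the symmetrized integrand. -/

variable {n : ℕ} {s p C μ : ℝ} {u : EuclideanSpace ℝ (Fin n) → ℝ} {e : EuclideanSpace ℝ (Fin n)}

lemma fracPLaplacianIntegrand_eq (x y : EuclideanSpace ℝ (Fin n)) :
    fracPLaplacianIntegrand s p u x y =
      oddPow p (u x - u y) / ‖x - y‖ ^ ((n : ℝ) + s * p) := rfl

/-- The integrand of the difference of the fractional `p`-Laplacians of `u` at the reflected point
of `x` and at `x`. -/
noncomputable def reflectDiff (s p : ℝ) (u : EuclideanSpace ℝ (Fin n) → ℝ)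
    (e : EuclideanSpace ℝ (Fin n)) (μ : ℝ) (x y : EuclideanSpace ℝ (Fin n)) : ℝ :=
  fracPLaplacianIntegrand s p u (planeReflect e μ x) (planeReflect e μ y) -
    fracPLaplacianIntegrand s p u x y

/-- `reflectDiff` symmetrized over a point and its reflection. -/
noncomputable def reflectDiffSymm (s p : ℝ) (u : EuclideanSpace ℝ (Fin n) → ℝ)
    (e : EuclideanSpace ℝ (Fin n)) (μ : ℝ) (x y : EuclideanSpace ℝ (Fin n)) : ℝ :=
  reflectDiff s p u e μ x y + reflectDiff s p u e μ x (planeReflect e μ y)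

lemma reflectDiff_eq (he : ‖e‖ = 1) (x y : EuclideanSpace ℝ (Fin n)) :
    reflectDiff s p u e μ x y =
      (oddPow p (u (planeReflect e μ x) - u (planeReflect e μ y)) - oddPow p (u x - u y)) /
        ‖x - y‖ ^ ((n : ℝ) + s * p) := by
  rw [reflectDiff, fracPLaplacianIntegrand_eq, fracPLaplacianIntegrand_eq,
    norm_planeReflect_sub he, sub_div]

lemma reflectDiff_planeReflect_eq (he : ‖e‖ = 1) (x y : EuclideanSpace ℝ (Fin n)) :
    reflectDiff s p u e μ x (planeReflect e μ y) =
      (oddPow p (u (planeReflect e μ x) - u y) - oddPow p (u x - u (planeReflect e μ y))) /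
        ‖x - planeReflect e μ y‖ ^ ((n : ℝ) + s * p) := by
  rw [reflectDiff_eq he, planeReflect_planeReflect he]

lemma norm_sub_lt_norm_sub_planeReflect (he : ‖e‖ = 1) {x y : EuclideanSpace ℝ (Fin n)}
    (hx : inner ℝ e x < μ) (hy : inner ℝ e y < μ) : ‖x - y‖ < ‖x - planeReflect e μ y‖ := by
  refine lt_of_pow_lt_pow_left₀ 2 (norm_nonneg _) ?_
  rw [norm_sub_planeReflect_sq he]
  have := mul_pos (sub_pos.2 hx) (sub_pos.2 hy)
  linarith

lemma oddPow_diff_nonpos (hp : 1 < p) {x y : EuclideanSpace ℝ (Fin n)}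
    (hmin : u (planeReflect e μ x) - u x ≤ u (planeReflect e μ y) - u y) :
    oddPow p (u (planeReflect e μ x) - u (planeReflect e μ y)) - oddPow p (u x - u y) ≤ 0 :=
  sub_nonpos.2 ((oddPow_strictMono hp).monotone (by linarith))

/-- Bound by the contribution of the difference of the kernels. -/
lemma reflectDiffSymm_le_kernel (he : ‖e‖ = 1) (hp : 1 < p) {x y : EuclideanSpace ℝ (Fin n)}
    (hneg : u (planeReflect e μ x) ≤ u x) :
    reflectDiffSymm s p u e μ x y ≤
      (oddPow p (u (planeReflect e μ x) - u (planeReflect e μ y)) - oddPow p (u x - u y)) *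
        ((‖x - y‖ ^ ((n : ℝ) + s * p))⁻¹ -
          (‖x - planeReflect e μ y‖ ^ ((n : ℝ) + s * p))⁻¹) := by
  rw [reflectDiffSymm, reflectDiff_eq he, reflectDiff_planeReflect_eq he, div_eq_mul_inv,
    div_eq_mul_inv]
  have hm := (oddPow_strictMono hp).monotone
  -- A·k₁ + B·k₂ = A(k₁ - k₂) + (A + B)k₂; regrouping the four terms of A + B, these two
  -- inequalities give A + B ≤ 0.
  have h1 := hm (show u (planeReflect e μ x) - u y ≤ u x - u y by linarith)
  have h2 := hm (show u (planeReflect e μ x) - u (planeReflect e μ y) ≤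
    u x - u (planeReflect e μ y) by linarith)
  have h3 : 0 ≤ (‖x - planeReflect e μ y‖ ^ ((n : ℝ) + s * p))⁻¹ := by positivity
  nlinarith [mul_nonneg h3 (sub_nonneg.2 h1), mul_nonneg h3 (sub_nonneg.2 h2)]

/-- Bound by the contribution of the difference of the values at the centre. -/
lemma reflectDiffSymm_le_value (he : ‖e‖ = 1) (hp : 1 < p) (ha : 0 < (n : ℝ) + s * p)
    {x y : EuclideanSpace ℝ (Fin n)}
    (hx : inner ℝ e x < μ) (hy : inner ℝ e y < μ) (hxy : x ≠ y)
    (hmin : u (planeReflect e μ x) - u x ≤ u (planeReflect e μ y) - u y) :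
    reflectDiffSymm s p u e μ x y ≤
      ((oddPow p (u (planeReflect e μ x) - u y) - oddPow p (u x - u y)) +
        (oddPow p (u (planeReflect e μ x) - u (planeReflect e μ y)) -
          oddPow p (u x - u (planeReflect e μ y)))) *
        (‖x - planeReflect e μ y‖ ^ ((n : ℝ) + s * p))⁻¹ := by
  rw [reflectDiffSymm, reflectDiff_eq he, reflectDiff_planeReflect_eq he, div_eq_mul_inv,
    div_eq_mul_inv]
  have h1 := oddPow_diff_nonpos hp hmin
  have h0 : 0 < ‖x - y‖ := norm_pos_iff.2 (sub_ne_zero.2 hxy)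
  have h2 : (‖x - planeReflect e μ y‖ ^ ((n : ℝ) + s * p))⁻¹ ≤ (‖x - y‖ ^ ((n : ℝ) + s * p))⁻¹ :=
    inv_anti₀ (by positivity) (Real.rpow_le_rpow h0.le
      (norm_sub_lt_norm_sub_planeReflect he hx hy).le ha.le)
  nlinarith [mul_nonneg_of_nonpos_of_nonpos h1 (sub_nonpos.2 h2)]

lemma kernel_diff_pos (he : ‖e‖ = 1) (ha : 0 < (n : ℝ) + s * p)
    {x y : EuclideanSpace ℝ (Fin n)}
    (hx : inner ℝ e x < μ) (hy : inner ℝ e y < μ) (hxy : x ≠ y) :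
    0 < (‖x - y‖ ^ ((n : ℝ) + s * p))⁻¹ -
          (‖x - planeReflect e μ y‖ ^ ((n : ℝ) + s * p))⁻¹ := by
  have h0 : 0 < ‖x - y‖ := norm_pos_iff.2 (sub_ne_zero.2 hxy)
  exact sub_pos.2 (inv_strictAnti₀ (by positivity) (Real.rpow_lt_rpow h0.le
      (norm_sub_lt_norm_sub_planeReflect he hx hy) ha))

lemma reflectDiffSymm_nonpos (he : ‖e‖ = 1) (hp : 1 < p) (ha : 0 < (n : ℝ) + s * p)
    {x y : EuclideanSpace ℝ (Fin n)}
    (hx : inner ℝ e x < μ) (hy : inner ℝ e y < μ) (hxy : x ≠ y)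
    (hneg : u (planeReflect e μ x) ≤ u x)
    (hmin : u (planeReflect e μ x) - u x ≤ u (planeReflect e μ y) - u y) :
    reflectDiffSymm s p u e μ x y ≤ 0 :=
  (reflectDiffSymm_le_kernel he hp hneg).trans
    (mul_nonpos_of_nonpos_of_nonneg (oddPow_diff_nonpos hp hmin)
      (kernel_diff_pos he ha hx hy hxy).le)

lemma continuousAt_reflectDiffSymm (he : ‖e‖ = 1) (hp : 1 < p) (hu : Continuous u)
    {x y : EuclideanSpace ℝ (Fin n)}
    (hx : inner ℝ e x < μ) (hy : inner ℝ e y < μ) (hxy : x ≠ y) :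
    ContinuousAt (reflectDiffSymm s p u e μ x) y := by
  have hG := oddPow_continuous hp
  have h0 : 0 < ‖x - y‖ := norm_pos_iff.2 (sub_ne_zero.2 hxy)
  have h1 := h0.trans (norm_sub_lt_norm_sub_planeReflect he hx hy)
  have h2 : reflectDiffSymm s p u e μ x = fun y =>
      (oddPow p (u (planeReflect e μ x) - u (planeReflect e μ y)) - oddPow p (u x - u y)) /
        ‖x - y‖ ^ ((n : ℝ) + s * p) +
      (oddPow p (u (planeReflect e μ x) - u y) - oddPow p (u x - u (planeReflect e μ y))) /
        ‖x - planeReflect e μ y‖ ^ ((n : ℝ) + s * p) := by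
    ext y
    rw [reflectDiffSymm, reflectDiff_eq he, reflectDiff_planeReflect_eq he]
  rw [h2]
  refine ContinuousAt.add (ContinuousAt.div (by fun_prop) ?_ (by positivity))
    (ContinuousAt.div (by fun_prop) ?_ (by positivity))
  · exact ContinuousAt.rpow_const (by fun_prop) (Or.inl h0.ne')
  · exact ContinuousAt.rpow_const (by fun_prop) (Or.inl h1.ne')

/-! ### Comparison of the principal values. -/

lemma preimage_planeReflect_ball_compl (he : ‖e‖ = 1) (x : EuclideanSpace ℝ (Fin n)) (ε : ℝ) :
    planeReflect e μ ⁻¹' (Metric.ball (planeReflect e μ x) ε)ᶜ = (Metric.ball x ε)ᶜ := by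
  ext y
  simp [dist_eq_norm, norm_planeReflect_sub he]

lemma tendsto_volume_ball_zero (he : ‖e‖ = 1) (x : EuclideanSpace ℝ (Fin n)) :
    Tendsto (fun ε : ℝ => volume (Metric.ball x ε)) (𝓝[>] 0) (𝓝 0) := by
  have : Nontrivial (EuclideanSpace ℝ (Fin n)) :=
    nontrivial_of_ne e 0 fun h => by simp [h] at he
  have h := tendsto_measure_biInter_gt (μ := (volume : Measure (EuclideanSpace ℝ (Fin n))))
    (s := fun r : ℝ => Metric.ball x r) (a := 0) (fun r _ => Metric.isOpen_ball.nullMeasurableSet)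
    (fun i j _ hij => Metric.ball_subset_ball hij)
    ⟨1, one_pos, Metric.isBounded_ball.measure_lt_top.ne⟩
  have h2 : (⋂ r > (0 : ℝ), Metric.ball x r) = {x} := by
    simpa using Metric.biInter_gt_ball x 0
  rw [h2, measure_singleton] at h
  exact h

/-- The quantitative comparison of the fractional `p`-Laplacians at a nonpositive minimum of
`u ∘ planeReflect - u` over the half-space. -/
theorem fracPLaplacian_reflect_sub_le (he : ‖e‖ = 1) (hp : 1 < p) (ha : 0 < (n : ℝ) + s * p)
    (hC : 0 < C) {x z : EuclideanSpace ℝ (Fin n)} {v v' m r : ℝ}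
    (hv : HasFracPLaplacianAt C s p u x v)
    (hv' : HasFracPLaplacianAt C s p u (planeReflect e μ x) v')
    (hx : inner ℝ e x < μ)
    (hneg : u (planeReflect e μ x) ≤ u x)
    (hmin : ∀ y, inner ℝ e y < μ →
      u (planeReflect e μ x) - u x ≤ u (planeReflect e μ y) - u y)
    (hball : ∀ y ∈ Metric.closedBall z r, inner ℝ e y < μ) (hxz : x ∉ Metric.closedBall z r)
    (hm : ∀ y ∈ Metric.closedBall z r, reflectDiffSymm s p u e μ x y ≤ -m) :
    v' - v ≤ -(C * m * volume.real (Metric.closedBall z r)) := by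
  set R := planeReflect e μ with hR
  set H : Set (EuclideanSpace ℝ (Fin n)) := {y | inner ℝ e y < μ} with hH
  set D := reflectDiff s p u e μ x with hD
  have hHm : MeasurableSet H := (isOpen_lt (by fun_prop) continuous_const).measurableSet
  have hMP : MeasurePreserving R volume volume := measurePreserving_planeReflect he μ
  have hemb : MeasurableEmbedding R := measurableEmbedding_planeReflect he μ
  have hRR : ∀ y, R (R y) = y := planeReflect_planeReflect he μ
  have hI1 : ∀ ε : ℝ, 0 < ε →
      IntegrableOn (fun y => fracPLaplacianIntegrand s p u (R x) (R y)) (Metric.ball x ε)ᶜ := by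
    intro ε hε
    have := (hMP.integrableOn_comp_preimage hemb).2 (hv'.1 ε hε)
    rwa [preimage_planeReflect_ball_compl he] at this
  have hDint : ∀ ε : ℝ, 0 < ε → IntegrableOn D (Metric.ball x ε)ᶜ := fun ε hε =>
    (hI1 ε hε).sub (hv.1 ε hε)
  have hDlim : Tendsto (fun ε : ℝ => C * ∫ y in (Metric.ball x ε)ᶜ, D y) (𝓝[>] 0)
      (𝓝 (v' - v)) := by
    refine (hv'.2.sub hv.2).congr' ?_
    filter_upwards [self_mem_nhdsWithin] with ε hε
    have h1 := hMP.setIntegral_preimage_emb hemb (fracPLaplacianIntegrand s p u (R x))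
      (Metric.ball (R x) ε)ᶜ
    rw [preimage_planeReflect_ball_compl he] at h1
    rw [← h1, ← mul_sub, ← integral_sub (hI1 ε hε) (hv.1 ε hε)]
    rfl
  have hballH : ∀ ε ≤ μ - inner ℝ e x, Metric.ball x ε ⊆ H := by
    intro ε hε y hy
    have h1 : inner ℝ e (y - x) ≤ ‖y - x‖ := by simpa [he] using real_inner_le_norm e (y - x)
    rw [inner_sub_right] at h1
    rw [Metric.mem_ball, dist_eq_norm] at hy
    simp only [hH, mem_ofPred_eq]; linarith
  set d := μ - inner ℝ e x with hd
  have hd0 : 0 < d := sub_pos.2 hx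
  have hHcD : IntegrableOn D Hᶜ :=
    (hDint d hd0).mono_set (compl_subset_compl.2 (hballH d le_rfl))
  have hpreH : R ⁻¹' H = {y | μ < inner ℝ e y} := by
    ext y
    simp only [hH, mem_preimage, mem_ofPred_eq, hR, inner_planeReflect he]
    constructor <;> intro h <;> linarith
  -- The singularity of D is at x, and R maps H to the other side of the plane, so D ∘ R is
  -- integrable on all of H, even near x.
  have hDR : IntegrableOn (fun y => D (R y)) H := by
    refine (hMP.integrableOn_comp_preimage hemb (f := fun y => D (R y)) (s := H)).1 ?_
    have h1 : (fun y => D (R y)) ∘ R = D := by ext y; simp [hRR]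
    rw [h1, hpreH]
    exact hHcD.mono_set fun y hy => by
      simp only [hH, mem_compl_iff, mem_ofPred_eq, not_lt] at hy ⊢; exact hy.le
  have hcompl : ∫ y in Hᶜ, D y ≤ ∫ y in H, D (R y) := by
    have h1 : ∫ y in H, D (R y) = ∫ y in R ⁻¹' H, D y := by
      rw [← hMP.setIntegral_preimage_emb hemb (fun y => D (R y)) H]
      simp only [hRR]
    have h2 : Hᶜ = {y | inner ℝ e y = μ} ∪ R ⁻¹' H := by
      rw [hpreH]
      ext y
      simp only [hH, mem_compl_iff, mem_union, mem_ofPred_eq, not_lt, le_iff_eq_or_lt, eq_comm]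
    have hTm : MeasurableSet {y : EuclideanSpace ℝ (Fin n) | inner ℝ e y = μ} :=
      (isClosed_eq (by fun_prop) continuous_const).measurableSet
    -- On the plane Ry = y, so D has a sign there and the measure of the plane is irrelevant.
    have h3 : ∫ y in {y | inner ℝ e y = μ}, D y ≤ 0 := by
      refine setIntegral_nonpos hTm fun y hy => ?_
      have hy' : planeReflect e μ y = y := planeReflect_of_inner_eq hy
      rw [hD, reflectDiff_eq he, hy']
      refine div_nonpos_of_nonpos_of_nonneg (sub_nonpos.2 ?_) (by positivity)
      exact (oddPow_strictMono hp).monotone (by linarith)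
    rw [h2] at hHcD
    rw [h1, h2, setIntegral_union _ (hemb.measurable hHm) (hHcD.mono_set subset_union_left)
      (hHcD.mono_set subset_union_right)]
    · linarith
    · rw [hpreH, Set.disjoint_left]
      intro y hy hy'
      simp only [mem_ofPred_eq] at hy hy'
      linarith
  set S := Metric.closedBall z r with hS
  have hSm : MeasurableSet S := Metric.isClosed_closedBall.measurableSet
  have hStop : volume S ≠ ⊤ := Metric.isBounded_closedBall.measure_lt_top.ne
  have hSx : ∀ᶠ ε in 𝓝[>] (0 : ℝ), S ⊆ (Metric.ball x ε)ᶜ := by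
    obtain ⟨ε₀, hε₀, h⟩ := Metric.isOpen_iff.1 (Metric.isClosed_closedBall.isOpen_compl) x hxz
    filter_upwards [Ioo_mem_nhdsGT hε₀] with ε hε y hy hy'
    exact h (Metric.ball_subset_ball hε.2.le hy') hy
  -- The excised ball is not reflection-invariant: folding onto H minus the ball leaves over the
  -- integral of D ∘ R on the ball, which tends to 0 with ε.
  have hmain : ∀ᶠ ε in 𝓝[>] (0 : ℝ), C * ∫ y in (Metric.ball x ε)ᶜ, D y ≤
      C * (-(m * volume.real S) +
        ∫ y in Metric.ball x ε, D (R y) ∂(volume.restrict H)) := by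
    filter_upwards [hSx, Ioo_mem_nhdsGT hd0] with ε hSε hε
    have hε0 : 0 < ε := hε.1
    have hBH := hballH ε hε.2.le
    refine mul_le_mul_of_nonneg_left ?_ hC.le
    have hBm : MeasurableSet (Metric.ball x ε) := Metric.isOpen_ball.measurableSet
    have hsub : H \ Metric.ball x ε ⊆ (Metric.ball x ε)ᶜ := fun y hy => hy.2
    have hdec : (Metric.ball x ε)ᶜ = (H \ Metric.ball x ε) ∪ Hᶜ := by
      ext y
      simp only [mem_compl_iff, mem_union, Set.mem_sdiff]
      have := @hBH y
      tauto
    have h1 : ∫ y in (Metric.ball x ε)ᶜ, D y =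
        (∫ y in H \ Metric.ball x ε, D y) + ∫ y in Hᶜ, D y := by
      rw [hdec, setIntegral_union _ hHm.compl ((hDint ε hε0).mono_set hsub) hHcD]
      exact Set.disjoint_left.2 fun y hy hy' => hy' hy.1
    have h2 : ∫ y in H, D (R y) = (∫ y in H \ Metric.ball x ε, D (R y)) +
        ∫ y in Metric.ball x ε, D (R y) := by
      rw [setIntegral_sdiff hBm hDR hBH]; ring
    have hFint : IntegrableOn (fun y => D y + D (R y)) (H \ Metric.ball x ε) :=
      ((hDint ε hε0).mono_set hsub).add (hDR.mono_set sdiff_subset)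
    have h3 : (∫ y in H \ Metric.ball x ε, D y) + (∫ y in H \ Metric.ball x ε, D (R y)) =
        ∫ y in H \ Metric.ball x ε, (D y + D (R y)) :=
      (integral_add ((hDint ε hε0).mono_set hsub) (hDR.mono_set sdiff_subset)).symm
    have hSsub : S ⊆ H \ Metric.ball x ε := fun y hy => ⟨hball y hy, hSε hy⟩
    have h4 : ∫ y in H \ Metric.ball x ε, (D y + D (R y)) ≤ ∫ y in S, (D y + D (R y)) := by
      have h5 := setIntegral_sdiff hSm hFint hSsub
      have h6 : ∫ y in (H \ Metric.ball x ε) \ S, (D y + D (R y)) ≤ 0 := by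
        refine setIntegral_nonpos ((hHm.diff hBm).diff hSm) fun y hy => ?_
        refine reflectDiffSymm_nonpos he hp ha hx hy.1.1 ?_ hneg (hmin y hy.1.1)
        rintro rfl
        exact hy.1.2 (Metric.mem_ball_self hε0)
      linarith
    have h7 : ∫ y in S, (D y + D (R y)) ≤ -(m * volume.real S) := by
      have h8 : ∫ y in S, (D y + D (R y)) ≤ ∫ _ in S, (-m) :=
        setIntegral_mono_on (hFint.mono_set hSsub) (integrableOn_const hStop) hSm hm
      rw [setIntegral_const, smul_eq_mul] at h8
      linarith
    rw [Measure.restrict_restrict hBm, inter_eq_left.2 hBH]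
    linarith
  have hzero : Tendsto (fun ε : ℝ => ∫ y in Metric.ball x ε, D (R y) ∂(volume.restrict H))
      (𝓝[>] 0) (𝓝 0) := by
    refine Integrable.tendsto_setIntegral_nhds_zero hDR ?_
    exact tendsto_of_tendsto_of_tendsto_of_le_of_le tendsto_const_nhds
      (tendsto_volume_ball_zero he x) (fun _ => zero_le) fun _ => Measure.restrict_apply_le _ _
  have hfin := le_of_tendsto_of_tendsto hDlim ((tendsto_const_nhds.add hzero).const_mul C) hmain
  linarith

/-! ### Negative minima and the strong maximum principle. -/

lemma isCompact_superlevel (hu : Continuous u)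
    (hulim : Tendsto u (cocompact (EuclideanSpace ℝ (Fin n))) (𝓝 0)) {c : ℝ} (hc : 0 < c) :
    IsCompact {x | c ≤ u x} := by
  obtain ⟨t, ht, hsub⟩ := mem_cocompact.1 (hulim.eventually_lt_const hc)
  refine ht.of_isClosed_subset (isClosed_le continuous_const hu) fun x hx => ?_
  by_contra hxt
  exact absurd (show c ≤ u x from hx) (not_le.2 (hsub hxt))

/-- A negative value of `u ∘ planeReflect - u` on the half-space forces a negative minimum. -/
lemma exists_negative_min (hu : Continuous u) (hupos : ∀ x, 0 < u x)
    (hulim : Tendsto u (cocompact (EuclideanSpace ℝ (Fin n))) (𝓝 0))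
    {x₁ : EuclideanSpace ℝ (Fin n)} (hx₁ : inner ℝ e x₁ < μ) (h₁ : u (planeReflect e μ x₁) < u x₁) :
    ∃ x, inner ℝ e x < μ ∧ u (planeReflect e μ x) < u x ∧
      ∀ y, inner ℝ e y < μ → u (planeReflect e μ x) - u x ≤ u (planeReflect e μ y) - u y := by
  -- Since w > -u, a point with w(y) ≤ w(x₁) must satisfy u(y) ≥ -w(x₁), so minimizing over this
  -- compact set suffices.
  have hK := (isCompact_superlevel hu hulim (sub_pos.2 h₁)).inter_right
    (isClosed_le (f := fun x : EuclideanSpace ℝ (Fin n) => inner ℝ e x) (by fun_prop)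
      (continuous_const (y := μ)))
  obtain ⟨x, hx, hmin⟩ := hK.exists_isMinOn (f := fun x => u (planeReflect e μ x) - u x)
    ⟨x₁, by simpa using (hupos _).le, hx₁.le⟩ (by fun_prop)
  have hx1 : u (planeReflect e μ x) - u x ≤ u (planeReflect e μ x₁) - u x₁ :=
    hmin ⟨by simpa using (hupos _).le, hx₁.le⟩
  have hxlt : u (planeReflect e μ x) < u x := by linarith
  refine ⟨x, lt_of_le_of_ne hx.2 fun h => ?_, hxlt, fun y hy => ?_⟩
  · rw [planeReflect_of_inner_eq h] at hxlt
    exact lt_irrefl _ hxlt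
  · by_cases hyu : u x₁ - u (planeReflect e μ x₁) ≤ u y
    · exact hmin ⟨hyu, hy.le⟩
    · have := hupos (planeReflect e μ y)
      linarith

/-- At a nonpositive minimum, strict negativity at one point gives a strict comparison. -/
lemma fracPLaplacian_reflect_sub_neg (he : ‖e‖ = 1) (hp : 1 < p) (ha : 0 < (n : ℝ) + s * p)
    (hC : 0 < C) (hu : Continuous u) {x z : EuclideanSpace ℝ (Fin n)} {v v' : ℝ}
    (hv : HasFracPLaplacianAt C s p u x v)
    (hv' : HasFracPLaplacianAt C s p u (planeReflect e μ x) v')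
    (hx : inner ℝ e x < μ)
    (hneg : u (planeReflect e μ x) ≤ u x)
    (hmin : ∀ y, inner ℝ e y < μ →
      u (planeReflect e μ x) - u x ≤ u (planeReflect e μ y) - u y)
    (hz : inner ℝ e z < μ) (hxz : x ≠ z) (hF : reflectDiffSymm s p u e μ x z < 0) :
    v' < v := by
  have h1 : ∀ᶠ y in 𝓝 z, reflectDiffSymm s p u e μ x y < reflectDiffSymm s p u e μ x z / 2 :=
    (continuousAt_reflectDiffSymm he hp hu hx hz hxz).eventually_lt_const (by linarith)
  have h2 : ∀ᶠ y : EuclideanSpace ℝ (Fin n) in 𝓝 z, inner ℝ e y < μ :=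
    (Continuous.tendsto (by fun_prop) z).eventually_lt_const hz
  obtain ⟨r, hr, hball⟩ := Metric.nhds_basis_closedBall.eventually_iff.1
    (h1.and (h2.and (eventually_ne_nhds hxz.symm)))
  have h3 := fracPLaplacian_reflect_sub_le (z := z) (r := r)
    (m := -(reflectDiffSymm s p u e μ x z / 2)) he hp ha hC hv hv' hx hneg hmin
    (fun y hy => (hball hy).2.1) (fun hxr => (hball hxr).2.2 rfl)
    (fun y hy => by simpa using (hball hy).1.le)
  have h4 : 0 < volume.real (Metric.closedBall z r) :=
    ENNReal.toReal_pos (Metric.measure_closedBall_pos _ _ hr).ne'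
      Metric.isBounded_closedBall.measure_lt_top.ne
  have h5 : 0 < -(reflectDiffSymm s p u e μ x z / 2) := by linarith
  have := mul_pos (mul_pos hC h5) h4
  linarith

/-- At a negative minimum, `u` is at least the size below which `g` is nonincreasing. -/
lemma le_of_negative_min (he : ‖e‖ = 1) (hp : 1 < p) (ha : 0 < (n : ℝ) + s * p)
    (hC : 0 < C) (hu : Continuous u) (hupos : ∀ x, 0 < u x) {g : ℝ → ℝ} {δ : ℝ}
    (hg : AntitoneOn g (Ioo 0 δ)) (husol : ∀ x, HasFracPLaplacianAt C s p u x (g (u x)))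
    {x : EuclideanSpace ℝ (Fin n)} (hx : inner ℝ e x < μ) (hneg : u (planeReflect e μ x) < u x)
    (hmin : ∀ y, inner ℝ e y < μ →
      u (planeReflect e μ x) - u x ≤ u (planeReflect e μ y) - u y) : δ ≤ u x := by
  by_contra! hδ
  -- Any second point of the half-space would do: the bound through the value at the centre is
  -- strictly negative at each of them.
  have hxz : x ≠ x - e := fun h => by
    have : e = 0 := sub_eq_self.1 h.symm
    simp [this] at he
  have hz : inner ℝ e (x - e) < μ := by
    rw [inner_sub_right, real_inner_self_eq_norm_sq, he]; linarith
  refine absurd (hg ⟨hupos _, hneg.trans hδ⟩ ⟨hupos _, hδ⟩ hneg.le) (not_le.2 ?_)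
  refine fracPLaplacian_reflect_sub_neg he hp ha hC hu (husol x) (husol _) hx hneg.le hmin hz hxz ?_
  refine (reflectDiffSymm_le_value he hp ha hx hz hxz (hmin _ hz)).trans_lt ?_
  have hG := oddPow_strictMono hp
  have h1 := hG (show u (planeReflect e μ x) - u (x - e) < u x - u (x - e) by linarith)
  have h2 := hG (show u (planeReflect e μ x) - u (planeReflect e μ (x - e)) <
    u x - u (planeReflect e μ (x - e)) by linarith)
  have h3 : 0 < ‖x - (x - e)‖ := norm_pos_iff.2 (sub_ne_zero.2 hxz)
  have h4 := h3.trans (norm_sub_lt_norm_sub_planeReflect he hx hz)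
  exact mul_neg_of_neg_of_pos (by linarith) (by positivity)

/-- The strong maximum principle for antisymmetric differences. -/
lemma strict_or_symmetric (he : ‖e‖ = 1) (hp : 1 < p) (ha : 0 < (n : ℝ) + s * p)
    (hC : 0 < C) (hu : Continuous u) {g : ℝ → ℝ}
    (husol : ∀ x, HasFracPLaplacianAt C s p u x (g (u x)))
    (hle : ∀ x, inner ℝ e x < μ → u x ≤ u (planeReflect e μ x)) :
    (∀ x, inner ℝ e x < μ → u x < u (planeReflect e μ x)) ∨
      ∀ x, u (planeReflect e μ x) = u x := by
  by_cases hstrict : ∀ x, inner ℝ e x < μ → u x < u (planeReflect e μ x)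
  · exact Or.inl hstrict
  refine Or.inr ?_
  push Not at hstrict
  obtain ⟨x, hx, hxle⟩ := hstrict
  have hxeq : u (planeReflect e μ x) = u x := le_antisymm hxle (hle x hx)
  have hmin : ∀ y, inner ℝ e y < μ →
      u (planeReflect e μ x) - u x ≤ u (planeReflect e μ y) - u y := fun y hy => by
    have := hle y hy
    linarith
  have hH : ∀ z, inner ℝ e z < μ → u (planeReflect e μ z) = u z := by
    intro z hz
    by_contra hne
    have hlt : u z < u (planeReflect e μ z) := lt_of_le_of_ne (hle z hz) (Ne.symm hne)
    have hxz : x ≠ z := by rintro rfl; exact hne hxeq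
    have h1 : reflectDiffSymm s p u e μ x z < 0 := by
      refine (reflectDiffSymm_le_kernel he hp hxle).trans_lt
        (mul_neg_of_neg_of_pos (sub_neg.2 (oddPow_strictMono hp ?_)) (kernel_diff_pos he ha hx hz hxz))
      linarith
    have h2 := fracPLaplacian_reflect_sub_neg he hp ha hC hu (husol x) (husol _) hx hxle hmin hz
      hxz h1
    rw [hxeq] at h2
    exact lt_irrefl _ h2
  intro z
  rcases lt_trichotomy (inner ℝ e z) μ with hz | hz | hz
  · exact hH z hz
  · rw [planeReflect_of_inner_eq hz]
  · have h := hH (planeReflect e μ z) (by rw [inner_planeReflect he]; linarith)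
    rw [planeReflect_planeReflect he] at h
    exact h.symm

/-! ### Analysis near the plane and continuation past it. -/

/-- At a local minimum of `u ∘ planeReflect - u` the derivatives of `u` in the direction `e` at the
point and at its reflection are opposite. -/
lemma fderiv_planeReflect_add_fderiv (he : ‖e‖ = 1) (hu : Differentiable ℝ u)
    {x : EuclideanSpace ℝ (Fin n)} (hx : inner ℝ e x < μ)
    (hmin : ∀ y, inner ℝ e y < μ →
      u (planeReflect e μ x) - u x ≤ u (planeReflect e μ y) - u y) :
    fderiv ℝ u (planeReflect e μ x) e + fderiv ℝ u x e = 0 := by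
  have hline : ∀ (a : EuclideanSpace ℝ (Fin n)) (c : ℝ),
      HasDerivAt (fun t : ℝ => u (a + t • (c • e))) (c * fderiv ℝ u a e) 0 := by
    intro a c
    have h1 : HasDerivAt (fun t : ℝ => a + t • (c • e)) (c • e) 0 := by
      simpa using ((hasDerivAt_id (0 : ℝ)).smul_const (c • e)).const_add a
    have h2 : HasFDerivAt u (fderiv ℝ u a) (a + (0 : ℝ) • (c • e)) := by
      simpa using (hu a).hasFDerivAt
    have h3 := h2.comp_hasDerivAt (0 : ℝ) h1
    rw [map_smul, smul_eq_mul] at h3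
    exact h3
  -- Moving x along e moves its reflection along -e.
  have hd := (hline (planeReflect e μ x) (-1)).sub (hline x 1)
  have hloc : IsLocalMin (fun t : ℝ => u (planeReflect e μ x + t • ((-1 : ℝ) • e)) -
      u (x + t • ((1 : ℝ) • e))) 0 := by
    have h1 : ∀ᶠ t : ℝ in 𝓝 0, inner ℝ e (x + t • e) < μ := by
      have h2 : Tendsto (fun t : ℝ => (inner ℝ e (x + t • e) : ℝ)) (𝓝 0) (𝓝 (inner ℝ e x)) :=
        Continuous.tendsto' (by fun_prop) _ _ (by simp)
      exact h2.eventually_lt_const hx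
    filter_upwards [h1] with t ht
    have := hmin _ ht
    rw [planeReflect_add_smul he] at this
    simpa [sub_eq_add_neg] using this
  have := hloc.hasDerivAt_eq_zero hd
  linarith

/-- Mean value theorem on the segment from x to its reflection, whose length is the factor in front
of the derivative. -/
lemma exists_reflect_sub_eq_fderiv (hu : Differentiable ℝ u)
    {x : EuclideanSpace ℝ (Fin n)} (hx : inner ℝ e x < μ) :
    ∃ τ ∈ Ioo 0 (2 * (μ - inner ℝ e x)),
      u (planeReflect e μ x) - u x =
        2 * (μ - inner ℝ e x) * fderiv ℝ u (x + τ • e) e := by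
  have hline : ∀ t : ℝ, HasDerivAt (fun t : ℝ => u (x + t • e)) (fderiv ℝ u (x + t • e) e) t := by
    intro t
    have h1 : HasDerivAt (fun t : ℝ => x + t • e) e t := by
      simpa using ((hasDerivAt_id t).smul_const e).const_add x
    exact (hu (x + t • e)).hasFDerivAt.comp_hasDerivAt t h1
  have hpos : 0 < 2 * (μ - inner ℝ e x) := by linarith
  obtain ⟨τ, hτ, h⟩ := exists_hasDerivAt_eq_slope (fun t : ℝ => u (x + t • e)) _ hpos
    (fun t _ => (hline t).continuousAt.continuousWithinAt) fun t _ => hline t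
  refine ⟨τ, hτ, ?_⟩
  rw [h]
  simp only [planeReflect, zero_smul, add_zero, sub_zero]
  rw [mul_div_cancel₀ _ hpos.ne']

/-- Near the reflecting plane the symmetrized integrand is bounded by a multiple of the distance
to the plane. -/
lemma reflectDiffSymm_le_dist_mul (he : ‖e‖ = 1) (hp : 1 < p) (ha : 0 < (n : ℝ) + s * p)
    {x y : EuclideanSpace ℝ (Fin n)}
    (hx : inner ℝ e x < μ) (hy : inner ℝ e y < μ) (hxy : x ≠ y)
    (hneg : u (planeReflect e μ x) ≤ u x)
    (hmin : u (planeReflect e μ x) - u x ≤ u (planeReflect e μ y) - u y) :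
    reflectDiffSymm s p u e μ x y ≤ (μ - inner ℝ e x) *
      ((oddPow p (u (planeReflect e μ x) - u (planeReflect e μ y)) - oddPow p (u x - u y)) *
        ((n + s * p) / 2 * (4 * (μ - inner ℝ e y)) *
          (‖x - planeReflect e μ y‖ ^ 2) ^ (-((n + s * p) / 2) - 1))) := by
  have h0 : 0 < ‖x - y‖ := norm_pos_iff.2 (sub_ne_zero.2 hxy)
  have h1 := h0.trans (norm_sub_lt_norm_sub_planeReflect he hx hy)
  -- The kernel is written through squared distances, whose difference is an explicit multiple of
  -- the distance from x to the plane.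
  have hk : ∀ r : ℝ, 0 < r → (r ^ 2) ^ (-((n + s * p) / 2)) = (r ^ ((n : ℝ) + s * p))⁻¹ := by
    intro r hr
    rw [← Real.rpow_natCast, ← Real.rpow_mul hr.le, ← Real.rpow_neg hr.le]
    congr 1; push_cast; ring
  have h2 := rpow_neg_sub_rpow_neg_ge (half_pos ha) (pow_pos h0 2) (pow_pos h1 2)
  rw [hk _ h0, hk _ h1] at h2
  refine (reflectDiffSymm_le_kernel he hp hneg).trans
    ((mul_le_mul_of_nonpos_left h2 (oddPow_diff_nonpos hp hmin)).trans_eq ?_)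
  have h3 : ‖x - planeReflect e μ y‖ ^ 2 - ‖x - y‖ ^ 2 =
      4 * (μ - inner ℝ e x) * (μ - inner ℝ e y) := by
    rw [norm_sub_planeReflect_sq he]; ring
  rw [h3]
  ring

/-- The boundary estimate: if `u` strictly increases under reflection in the plane at `l`, then at
negative minima close to a point `a` of this plane the reflected fractional `p`-Laplacian is
smaller by at least a fixed multiple of the distance to the plane. -/
lemma boundary_estimate (he : ‖e‖ = 1) (hp : 1 < p) (ha : 0 < (n : ℝ) + s * p)
    (hC : 0 < C) (hu : Continuous u) {g : ℝ → ℝ}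
    (husol : ∀ x, HasFracPLaplacianAt C s p u x (g (u x))) {l : ℝ}
    (hstrict : ∀ x, inner ℝ e x < l → u x < u (planeReflect e l x))
    {a : EuclideanSpace ℝ (Fin n)} (hal : inner ℝ e a = l) :
    ∃ c > 0, ∀ᶠ q : ℝ × EuclideanSpace ℝ (Fin n) in 𝓝 (l, a),
      inner ℝ e q.2 < q.1 → u (planeReflect e q.1 q.2) ≤ u q.2 →
      (∀ y, inner ℝ e y < q.1 →
        u (planeReflect e q.1 q.2) - u q.2 ≤ u (planeReflect e q.1 y) - u y) →
      g (u (planeReflect e q.1 q.2)) - g (u q.2) ≤ -(c * (q.1 - inner ℝ e q.2)) := by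
  set b : ℝ := (n + s * p) / 2 with hb
  -- Φ is the bound of `reflectDiffSymm_le_dist_mul` with the distance from the centre to the plane
  -- divided out, so it stays meaningful and negative when the centre reaches the plane.
  set Φ : ℝ × EuclideanSpace ℝ (Fin n) → EuclideanSpace ℝ (Fin n) → ℝ := fun q y =>
    (oddPow p (u (planeReflect e q.1 q.2) - u (planeReflect e q.1 y)) - oddPow p (u q.2 - u y)) *
        (b * (4 * (q.1 - inner ℝ e y)) * (‖q.2 - planeReflect e q.1 y‖ ^ 2) ^ (-b - 1)) with hΦ
  -- Two units behind the plane, so that the unit ball about z stays at distance at least 1 from it.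
  set z : EuclideanSpace ℝ (Fin n) := a - (2 : ℝ) • e with hz
  set S := Metric.closedBall z 1 with hS
  have hSin : ∀ y ∈ S, inner ℝ e y ≤ l - 1 := by
    intro y hy
    rw [hS, Metric.mem_closedBall, dist_eq_norm] at hy
    have h1 : inner ℝ e (y - z) ≤ ‖y - z‖ := by simpa [he] using real_inner_le_norm e (y - z)
    rw [inner_sub_right, hz, inner_sub_right, real_inner_smul_right, real_inner_self_eq_norm_sq, he,
      hal] at h1
    linarith
  have hRa : planeReflect e l a = a := planeReflect_of_inner_eq hal
  have hdist : ∀ y ∈ S, 0 < ‖a - planeReflect e l y‖ := by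
    intro y hy
    refine norm_pos_iff.2 (sub_ne_zero.2 fun h => ?_)
    have h1 := congrArg (inner ℝ e) h
    rw [hal, inner_planeReflect he] at h1
    linarith [hSin y hy]
  have hcont : ∀ y ∈ S, ContinuousAt
      (fun w : (ℝ × EuclideanSpace ℝ (Fin n)) × EuclideanSpace ℝ (Fin n) => Φ w.1 w.2)
      ((l, a), y) := by
    intro y hy
    have hG := oddPow_continuous hp
    refine ContinuousAt.mul (by fun_prop) (ContinuousAt.mul (by fun_prop) ?_)
    exact ContinuousAt.rpow_const (by fun_prop) (Or.inl (pow_pos (hdist y hy) 2).ne')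
  have hnegΦ : ∀ y ∈ S, Φ (l, a) y < 0 := by
    intro y hy
    have hyl : inner ℝ e y < l := by linarith [hSin y hy]
    have h1 := hdist y hy
    have h2 : 0 < l - inner ℝ e y := sub_pos.2 hyl
    have h3 : 0 < b := half_pos ha
    refine mul_neg_of_neg_of_pos (sub_neg.2 (oddPow_strictMono hp ?_)) (by positivity)
    have := hstrict y hyl
    simp only [hRa]
    linarith
  have hScomp : IsCompact S := isCompact_closedBall _ _
  obtain ⟨y₀, hy₀, hmax⟩ := hScomp.exists_isMaxOn (f := Φ (l, a))
    ⟨z, Metric.mem_closedBall_self one_pos.le⟩ fun y hy =>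
      ((hcont y hy).comp (f := fun y => ((l, a), y)) (by fun_prop)).continuousWithinAt
  -- Half of the extremal value leaves room to perturb (l, a); compactness of S makes the
  -- perturbation uniform in y.
  set m := -(Φ (l, a) y₀) / 2 with hm
  have hm0 : 0 < m := by have := hnegΦ y₀ hy₀; simp only [hm]; linarith
  have htube : ∀ᶠ q in 𝓝 (l, a), ∀ y ∈ S, Φ q y < -m := by
    refine hScomp.eventually_forall_of_forall_eventually fun y hy => ?_
    refine (hcont y hy).eventually_lt_const ?_
    have h1 : Φ (l, a) y ≤ Φ (l, a) y₀ := hmax hy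
    have := hnegΦ y₀ hy₀
    simp only [hm]
    linarith
  have hvol : 0 < volume.real S :=
    ENNReal.toReal_pos (Metric.measure_closedBall_pos _ _ one_pos).ne'
      Metric.isBounded_closedBall.measure_lt_top.ne
  have h1 : ∀ᶠ q : ℝ × EuclideanSpace ℝ (Fin n) in 𝓝 (l, a), l - 1 < q.1 :=
    (continuous_fst.tendsto _).eventually_const_lt (by simp)
  have h2 : ∀ᶠ q : ℝ × EuclideanSpace ℝ (Fin n) in 𝓝 (l, a), l - 1 < inner ℝ e q.2 :=
    (Continuous.tendsto (f := fun q : ℝ × EuclideanSpace ℝ (Fin n) => (inner ℝ e q.2 : ℝ))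
      (by fun_prop) _).eventually_const_lt (by simp [hal])
  refine ⟨C * m * volume.real S, by positivity, ?_⟩
  filter_upwards [htube, h1, h2] with q hq hq1 hq2 hx hneg hmin
  have hxS : q.2 ∉ S := fun h => by linarith [hSin _ h]
  have hkey := fracPLaplacian_reflect_sub_le (z := z) (r := 1) (m := m * (q.1 - inner ℝ e q.2))
    he hp ha hC (husol q.2) (husol _) hx hneg hmin
    (fun y hy => (hSin y hy).trans_lt hq1) hxS (fun y hy => ?_)
  · refine hkey.trans_eq ?_
    ring
  · have hyμ := (hSin y hy).trans_lt hq1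
    refine (reflectDiffSymm_le_dist_mul he hp ha hx hyμ (fun h => hxS (h ▸ hy)) hneg
      (hmin y hyμ)).trans ?_
    exact (mul_le_mul_of_nonneg_left (hq y hy).le (sub_pos.2 hx).le).trans_eq (by ring)

/-- If `u` strictly increases under reflection in the plane at `l`, the plane can be moved a little
further. -/
lemma exists_moving_plane_step (he : ‖e‖ = 1) (hp : 1 < p) (ha : 0 < (n : ℝ) + s * p)
    (hC : 0 < C) (hu : ContDiff ℝ 1 u) (hupos : ∀ x, 0 < u x)
    (hulim : Tendsto u (cocompact (EuclideanSpace ℝ (Fin n))) (𝓝 0))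
    {g : ℝ → ℝ} (hgLip : LocallyLipschitzOn (Ioi 0) g) {δ : ℝ} (hδ : 0 < δ)
    (hg : AntitoneOn g (Ioo 0 δ))
    (husol : ∀ x, HasFracPLaplacianAt C s p u x (g (u x))) {l : ℝ}
    (hstrict : ∀ x, inner ℝ e x < l → u x < u (planeReflect e l x)) :
    ∃ ε > 0, ∀ μ ∈ Ico l (l + ε), ∀ x, inner ℝ e x < μ → u x ≤ u (planeReflect e μ x) := by
  have huc := hu.continuous
  by_contra! hcon
  have hseq : ∀ k : ℕ, ∃ μ ∈ Ico l (l + 1 / ((k : ℝ) + 1)), ∃ x, inner ℝ e x < μ ∧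
      u (planeReflect e μ x) < u x ∧
      ∀ y, inner ℝ e y < μ → u (planeReflect e μ x) - u x ≤ u (planeReflect e μ y) - u y := by
    intro k
    obtain ⟨μ, hμ, x₁, hx₁, h₁⟩ := hcon (1 / ((k : ℝ) + 1)) (by positivity)
    exact ⟨μ, hμ, exists_negative_min huc hupos hulim hx₁ h₁⟩
  choose μ hμ x hx hneg hmin using hseq
  obtain ⟨a, -, φ, hφ, hxa⟩ := (isCompact_superlevel huc hulim hδ).tendsto_subseq fun k =>
    le_of_negative_min he hp ha hC huc hupos hg husol (hx k) (hneg k) (hmin k)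
  have hμl : Tendsto (fun k => μ (φ k)) atTop (𝓝 l) := by
    have h1 : Tendsto (fun k : ℕ => l + 1 / ((k : ℝ) + 1)) atTop (𝓝 l) := by
      simpa using tendsto_one_div_add_atTop_nhds_zero_nat.const_add l
    exact (tendsto_of_tendsto_of_tendsto_of_le_of_le tendsto_const_nhds h1 (fun k => (hμ k).1)
      fun k => (hμ k).2.le).comp hφ.tendsto_atTop
  have hxa' : Tendsto (fun k => x (φ k)) atTop (𝓝 a) := hxa
  have hinner : Tendsto (fun k => (inner ℝ e (x (φ k)) : ℝ)) atTop (𝓝 (inner ℝ e a)) :=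
    tendsto_const_nhds.inner hxa'
  have hRlim : Tendsto (fun k => planeReflect e (μ (φ k)) (x (φ k))) atTop
      (𝓝 (planeReflect e l a)) := hμl.planeReflect e hxa'
  -- A limit strictly inside the half-space would satisfy u(Ra) ≤ u(a), against `hstrict`.
  have hal : inner ℝ e a = l := by
    refine le_antisymm (le_of_tendsto_of_tendsto' hinner hμl fun k => (hx _).le) ?_
    by_contra! hlt
    exact absurd (le_of_tendsto_of_tendsto' ((huc.tendsto _).comp hRlim) ((huc.tendsto _).comp hxa')
      fun k => (hneg (φ k)).le) (not_le.2 (hstrict a hlt))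
  rw [planeReflect_of_inner_eq hal] at hRlim
  have hdu : Continuous fun y => fderiv ℝ u y e :=
    (hu.continuous_fderiv one_ne_zero).clm_apply continuous_const
  -- Both opposite derivatives converge to the derivative at a, because the points and their
  -- reflections merge there.
  have hda : fderiv ℝ u a e = 0 := by
    have h1 := ((hdu.tendsto _).comp hRlim).add ((hdu.tendsto _).comp hxa')
    have h2 := tendsto_nhds_unique h1 (tendsto_const_nhds.congr fun k =>
      (fderiv_planeReflect_add_fderiv he (hu.differentiable one_ne_zero) (hx (φ k))
        (hmin (φ k))).symm)
    linarith
  choose τ hτ hτeq using fun k =>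
    exists_reflect_sub_eq_fderiv (hu.differentiable one_ne_zero) (hx (φ k))
  have hτ0 : Tendsto τ atTop (𝓝 0) := by
    have h1 : Tendsto (fun k => 2 * (μ (φ k) - inner ℝ e (x (φ k)))) atTop (𝓝 0) := by
      have := (hμl.sub hinner).const_mul 2
      simpa [hal] using this
    exact squeeze_zero (fun k => (hτ k).1.le) (fun k => (hτ k).2.le) h1
  have hd0 : Tendsto (fun k => fderiv ℝ u (x (φ k) + τ k • e) e) atTop (𝓝 0) := by
    have h1 : Tendsto (fun k => x (φ k) + τ k • e) atTop (𝓝 a) := by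
      simpa using hxa'.add (hτ0.smul_const e)
    rw [← hda]
    exact (hdu.tendsto a).comp h1
  obtain ⟨c, hc, hest⟩ := boundary_estimate he hp ha hC huc husol hstrict hal
  obtain ⟨K, t, ht, hK⟩ := hgLip (hupos a)
  rw [nhdsWithin_eq_nhds.2 (Ioi_mem_nhds (hupos a))] at ht
  have hsmall : ∀ᶠ k in atTop, 2 * (K : ℝ) * |fderiv ℝ u (x (φ k) + τ k • e) e| < c := by
    have h1 := hd0.abs.const_mul (2 * (K : ℝ))
    rw [abs_zero, mul_zero] at h1
    exact h1.eventually_lt_const hc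
  obtain ⟨k, hk1, hk2, hk3, hk4⟩ := ((hμl.prodMk_nhds hxa').eventually hest |>.and
    ((((huc.tendsto a).comp hRlim).eventually ht).and
      ((((huc.tendsto a).comp hxa').eventually ht).and hsmall))).exists
  -- With d the distance to the plane, the decrease of g is at least c·d, yet the Lipschitz bound
  -- keeps it at most 2K·d·|∂ₑu|, which is less than c·d.
  have h1 := hk1 (hx _) (hneg _).le (hmin _)
  have hdpos : 0 < μ (φ k) - inner ℝ e (x (φ k)) := sub_pos.2 (hx _)
  have h2 := hK.dist_le_mul _ hk2 _ hk3
  simp only [Function.comp, Real.dist_eq, hτeq k, abs_mul, abs_two, abs_of_pos hdpos] at h2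
  have h3 := neg_le_of_abs_le h2
  nlinarith [mul_lt_mul_of_pos_right hk4 hdpos]

/-! ### Symmetry planes in a fixed direction. -/

/-- A positive function vanishing at infinity is symmetric about at most one of a family of
parallel planes. -/
lemma eq_of_symmetric_of_symmetric (he : ‖e‖ = 1) (hu : Continuous u) (hupos : ∀ x, 0 < u x)
    (hulim : Tendsto u (cocompact (EuclideanSpace ℝ (Fin n))) (𝓝 0)) {l μ : ℝ}
    (hl : ∀ x, u (planeReflect e l x) = u x) (hμ : ∀ x, u (planeReflect e μ x) = u x) : l = μ := by
  by_contra hne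
  -- Two parallel reflections compose to a translation, and a nonzero period contradicts decay at
  -- infinity.
  have htrans : ∀ x, u (x + (2 * (l - μ)) • e) = u x := by
    intro x
    have h1 : planeReflect e l (planeReflect e μ x) = x + (2 * (l - μ)) • e := by
      conv_lhs => rw [planeReflect, inner_planeReflect he, planeReflect]
      module
    rw [← h1, hl, hμ]
  have hk : ∀ k : ℕ, u ((k * (2 * (l - μ))) • e) = u 0 := by
    intro k
    induction k with
    | zero => simp
    | succ k ih =>
      rw [← ih, ← htrans ((k * (2 * (l - μ))) • e)]
      congr 1
      push_cast
      module
  obtain ⟨r, hr⟩ := (isCompact_superlevel hu hulim (hupos 0)).isBounded.exists_norm_le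
  have hpos : 0 < |2 * (l - μ)| := abs_pos.2 (mul_ne_zero two_ne_zero (sub_ne_zero.2 hne))
  obtain ⟨k, hkr⟩ := exists_nat_gt (r / |2 * (l - μ)|)
  have h1 := hr _ (hk k).ge
  rw [norm_smul, he, Real.norm_eq_abs, abs_mul, Nat.abs_cast, mul_one] at h1
  rw [div_lt_iff₀ hpos] at hkr
  linarith

/-- The method of moving planes in a fixed direction. -/
theorem exists_symmetry_plane (he : ‖e‖ = 1) (hp : 1 < p) (ha : 0 < (n : ℝ) + s * p)
    (hC : 0 < C) (hu : ContDiff ℝ 1 u) (hupos : ∀ x, 0 < u x)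
    (hulim : Tendsto u (cocompact (EuclideanSpace ℝ (Fin n))) (𝓝 0))
    {g : ℝ → ℝ} (hgLip : LocallyLipschitzOn (Ioi 0) g) {δ : ℝ} (hδ : 0 < δ)
    (hg : AntitoneOn g (Ioo 0 δ))
    (husol : ∀ x, HasFracPLaplacianAt C s p u x (g (u x))) :
    ∃ l : ℝ, (∀ x, u (planeReflect e l x) = u x) ∧
      ∀ μ < l, ∀ x, inner ℝ e x < μ → u x < u (planeReflect e μ x) := by
  have huc := hu.continuous
  set Λ : Set ℝ := {l | ∀ μ ≤ l, ∀ x, inner ℝ e x < μ → u x ≤ u (planeReflect e μ x)} with hΛ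
  -- Negative minima lie in {u ≥ δ}, contained in the ball of radius r, and no half-space below
  -- level -r meets that ball.
  have hne : Λ.Nonempty := by
    obtain ⟨r, hr⟩ := (isCompact_superlevel huc hulim hδ).isBounded.exists_norm_le
    refine ⟨-r, fun μ hμ x₁ hx₁ => ?_⟩
    by_contra! h₁
    obtain ⟨x, hx, hneg, hmin⟩ := exists_negative_min huc hupos hulim hx₁ h₁
    have h2 := hr x (le_of_negative_min he hp ha hC huc hupos hg husol hx hneg hmin)
    have h3 := neg_le_of_abs_le (abs_real_inner_le_norm e x)
    rw [he, one_mul] at h3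
    linarith
  -- For l in Λ above r, comparison at the origin would give u(2le) ≥ u(0), forcing 2l ≤ r.
  have hbdd : BddAbove Λ := by
    obtain ⟨r, hr⟩ := (isCompact_superlevel huc hulim (hupos 0)).isBounded.exists_norm_le
    have hr0 : 0 ≤ r := by simpa using hr 0 (le_refl (u 0))
    refine ⟨r, fun l hl => ?_⟩
    by_contra! hlt
    have h1 := hr _ (hl l le_rfl 0 (by simpa using hr0.trans_lt hlt))
    rw [planeReflect, zero_add, inner_zero_right, sub_zero, norm_smul, he, mul_one,
      Real.norm_eq_abs, abs_of_pos (by linarith)] at h1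
    linarith
  have hlt : ∀ μ < sSup Λ, ∀ x, inner ℝ e x < μ → u x ≤ u (planeReflect e μ x) := by
    intro μ hμ
    obtain ⟨l, hl, hμl⟩ := exists_lt_of_lt_csSup hne hμ
    exact hl μ hμl.le
  have hsup : ∀ x, inner ℝ e x < sSup Λ → u x ≤ u (planeReflect e (sSup Λ) x) := by
    intro x hx
    have h1 : Tendsto (fun μ => u (planeReflect e μ x)) (𝓝[<] (sSup Λ))
        (𝓝 (u (planeReflect e (sSup Λ) x))) :=
      (Continuous.tendsto (by fun_prop) _).mono_left nhdsWithin_le_nhds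
    refine ge_of_tendsto h1 ?_
    filter_upwards [Ioo_mem_nhdsLT hx] with μ hμ using hlt μ hμ.2 x hμ.1
  have hsym : ∀ x, u (planeReflect e (sSup Λ) x) = u x := by
    refine (strict_or_symmetric he hp ha hC huc husol hsup).resolve_left fun hstrict => ?_
    obtain ⟨ε, hε, h⟩ :=
      exists_moving_plane_step he hp ha hC hu hupos hulim hgLip hδ hg husol hstrict
    have hmem : sSup Λ + ε / 2 ∈ Λ := by
      intro μ hμ
      rcases lt_or_ge μ (sSup Λ) with hμ' | hμ'
      · exact hlt μ hμ'
      · exact h μ ⟨hμ', by linarith⟩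
    linarith [le_csSup hbdd hmem]
  refine ⟨sSup Λ, hsym, fun μ hμ => ?_⟩
  refine (strict_or_symmetric he hp ha hC huc husol (hlt μ hμ)).resolve_right fun h => ?_
  exact hμ.ne (eq_of_symmetric_of_symmetric he huc hupos hulim h hsym)

/-! ### From symmetry planes to radial symmetry. -/

/-- A function with a maximum at `a` that has a symmetry plane in every direction, and is strictly
monotone before it, is radially decreasing about `a`. -/
lemma isRadiallyDecreasingAbout_of_planes (hn : 1 ≤ n) {a : EuclideanSpace ℝ (Fin n)}
    (hmax : ∀ x, u x ≤ u a)
    (hplane : ∀ e : EuclideanSpace ℝ (Fin n), ‖e‖ = 1 →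
      ∃ l : ℝ, (∀ x, u (planeReflect e l x) = u x) ∧
        ∀ μ < l, ∀ x, inner ℝ e x < μ → u x < u (planeReflect e μ x)) :
    IsRadiallyDecreasingAbout u a := by
  have hcentre : ∀ e : EuclideanSpace ℝ (Fin n), ‖e‖ = 1 →
      (∀ x, u (planeReflect e (inner ℝ e a) x) = u x) ∧
        ∀ μ < inner ℝ e a, ∀ x, inner ℝ e x < μ → u x < u (planeReflect e μ x) := by
    intro e he
    obtain ⟨l, hsym, hstrict⟩ := hplane e he
    -- No maximum point lies strictly before the plane; applied to a and to its reflection, this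
    -- puts a on the plane.
    have hside : ∀ b, u b = u a → l ≤ inner ℝ e b := by
      intro b hb
      by_contra! hlt
      obtain ⟨μ, hbμ, hμl⟩ := exists_between hlt
      have := hstrict μ hμl b hbμ
      linarith [hmax (planeReflect e μ b)]
    have h1 := hside a rfl
    have h2 := hside _ (hsym a)
    rw [inner_planeReflect he] at h2
    obtain rfl : l = inner ℝ e a := le_antisymm h1 (by linarith)
    exact ⟨hsym, hstrict⟩
  set e₀ : EuclideanSpace ℝ (Fin n) := EuclideanSpace.single ⟨0, hn⟩ 1 with he₀def
  have he₀ : ‖e₀‖ = 1 := by simp [he₀def]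
  refine ⟨fun t => u (a + t • e₀), fun t₁ ht₁ t₂ _ h12 => ?_, fun x => ?_⟩
  -- In direction -e₀ the outer point lies before the plane midway between the two points, and
  -- reflection sends it to the inner one.
  · have hne : ‖-e₀‖ = 1 := by rw [norm_neg, he₀]
    have hin : ∀ t : ℝ, inner ℝ (-e₀) (a + t • e₀) = inner ℝ (-e₀) a - t := by
      intro t
      rw [inner_add_right, real_inner_smul_right, inner_neg_left e₀ e₀,
        real_inner_self_eq_norm_sq, he₀]
      ring
    have ht₁' : 0 ≤ t₁ := ht₁
    have h := (hcentre _ hne).2 (inner ℝ (-e₀) a - (t₁ + t₂) / 2) (by linarith) (a + t₂ • e₀)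
      (by rw [hin]; linarith)
    have h2 : planeReflect (-e₀) (inner ℝ (-e₀) a - (t₁ + t₂) / 2) (a + t₂ • e₀) = a + t₁ • e₀ := by
      rw [planeReflect, hin]
      module
    rwa [h2] at h
  -- x and y are equidistant from a, so reflection in the plane through a normal to y - x sends x to
  -- y.
  · set y := a + ‖x - a‖ • e₀ with hy
    change u x = u y
    by_cases hxy : y - x = 0
    · rw [sub_eq_zero.1 hxy]
    have hpos : 0 < ‖y - x‖ := norm_pos_iff.2 hxy
    have he : ‖(‖y - x‖⁻¹ • (y - x))‖ = 1 := by
      rw [norm_smul, norm_inv, norm_norm, inv_mul_cancel₀ hpos.ne']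
    have hya : ‖y - a‖ = ‖x - a‖ := by
      rw [hy, add_sub_cancel_left, norm_smul, he₀, norm_norm, mul_one]
    have hin : 2 * inner ℝ (y - x) (a - x) = ‖y - x‖ ^ 2 := by
      have h1 := norm_sub_sq_real (y - x) (a - x)
      rw [sub_sub_sub_cancel_right, hya, norm_sub_rev a x] at h1
      linarith
    have hR : planeReflect (‖y - x‖⁻¹ • (y - x)) (inner ℝ (‖y - x‖⁻¹ • (y - x)) a) x = y := by
      rw [planeReflect, ← inner_sub_right, real_inner_smul_left, smul_smul]
      have h1 : 2 * (‖y - x‖⁻¹ * inner ℝ (y - x) (a - x)) * ‖y - x‖⁻¹ = 1 := by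
        have h2 : 2 * (‖y - x‖⁻¹ * inner ℝ (y - x) (a - x)) * ‖y - x‖⁻¹ =
          (2 * inner ℝ (y - x) (a - x)) * (‖y - x‖⁻¹ * ‖y - x‖⁻¹) := by ring
        rw [h2, hin]
        field_simp
      rw [h1, one_smul, add_sub_cancel]
    rw [← (hcentre _ he).1 x, hR]

theorem theorem4p1 (n : ℕ) (hn : 1 ≤ n) (C s p : ℝ) (hC : 0 < C)
    (hs0 : 0 < s) (hs1 : s < 1) (hp : 1 < p)
    (g : ℝ → ℝ) (hgLip : LocallyLipschitzOn (Ioi 0) g)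
    (hg : ∃ δ : ℝ, 0 < δ ∧ ∀ t ∈ Ioo 0 δ, DifferentiableAt ℝ g t ∧ deriv g t ≤ 0)
    (u : EuclideanSpace ℝ (Fin n) → ℝ)
    (huC : IsC11Loc u) (huL : MemLsp s p u) (hupos : ∀ x, 0 < u x)
    (husol : ∀ x, HasFracPLaplacianAt C s p u x (g (u x)))
    (hulim : Tendsto u (cocompact (EuclideanSpace ℝ (Fin n))) (𝓝 0)) :
    ∃ x₀ : EuclideanSpace ℝ (Fin n), IsRadiallyDecreasingAbout u x₀ := by
  obtain ⟨δ, hδ, hgδ⟩ := hg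
  have hganti : AntitoneOn g (Ioo 0 δ) := by
    refine antitoneOn_of_deriv_nonpos (convex_Ioo 0 δ)
      (fun t ht => (hgδ t ht).1.continuousAt.continuousWithinAt) ?_ ?_
    · exact fun t ht => (hgδ t (interior_subset ht)).1.differentiableWithinAt
    · exact fun t ht => (hgδ t (interior_subset ht)).2
  have ha : 0 < (n : ℝ) + s * p := by positivity
  obtain ⟨a, ha0, hmax⟩ := (isCompact_superlevel huC.1.continuous hulim (hupos 0)).exists_isMaxOn
    ⟨0, le_refl (u 0)⟩ huC.1.continuous.continuousOn
  refine ⟨a, isRadiallyDecreasingAbout_of_planes hn (fun x => ?_) fun e he =>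
    exists_symmetry_plane he hp ha hC huC.1 hupos hulim hgLip hδ hganti husol⟩
  rcases le_total (u 0) (u x) with h | h
  · exact hmax h
  · exact h.trans ha0
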